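/- All posets are finite. The height of a poset is the maximum number of elements in a chain, and its cover graph joins $x$ and $y$ whenever one of them covers the other. For a poset $P$, let $\mathrm{Inc}(P)$ be the set of ordered pairs of incomparable elements of $P$, and let $\mathrm{Inc}(\mathrm{Min}(P),\mathrm{Max}(P))$ be the set of those $(a,b)\in\mathrm{Inc}(P)$ with $a$ minimal and $b$ maximal in $P$. A set $R\subseteq\mathrm{Inc}(P)$ is reversible if some linear extension $L$ of $P$ has $x>_L y$ for all $(x,y)\in R$; for $I\subseteq\mathrm{Inc}(P)$, $\dim(I)$ is the least $d\ge 1$ such that $I$ can be covered by $d$ reversible sets. A non-empty set $I\subseteq\mathrm{Inc}(\mathrm{Min}(P),\mathrm{Max}(P))$ is doubly constrained in $P$ by $(x_0,y_0)$ if $x_0<_P y_0$ and, for every $(a,b)\in I$, $x_0<_P b$ and $a<_P y_0$. It is doubly constrained in $P$ if it is so by some pair $(x_0,y_0)$, and doubly exposed in $P$ if it is so by some pair $(x_0,y_0)$ such that the cover graph of $P$ has a plane drawing with $x_0$ and $y_0$ on (the boundary of) the same face. Here a plane drawing of a graph represents the vertices by distinct points of the plane and the edges by simple polygonal arcs joining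 their ends, the interior of an edge containing no vertex and no point of another edge; its faces are the connected components of the complement of the drawing. A graph is planar if it has a plane drawing. **Lemma.** Let $P$ be a poset of height $h$ with a planar cover graph, and let $I\subseteq\mathrm{Inc}(\mathrm{Min}(P),\mathrm{Max}(P))$ be doubly constrained in $P$. Then there are a poset $Q$ and a set $J\subseteq\mathrm{Inc}(\mathrm{Min}(Q),\mathrm{Max}(Q))$ such that 1. the height of $Q$ is at most $h$; 2. the cover graph of $Q$ is (isomorphic to) a subgraph of the cover graph of $P$; 3. $J$ is doubly exposed in $Q$; and $$\dim(I)\le 2(h-1)\dim(J).$$ -/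

import Mathlib

universe u

/-! ### Incomparable pairs, reversible sets, dimension, height -/

namespace PosetDim

/-- `Inc(P)`: the ordered pairs of incomparable elements of `P`. -/
def incPairs (P : Type*) [PartialOrder P] : Set (P × P) :=
  {p | IncompRel (· ≤ ·) p.1 p.2}

/-- `Inc(Min(P), Max(P))`: the incomparable pairs `(a, b)` with `a` a minimal element
and `b` a maximal element of `P`. -/
def incMinMax (P : Type*) [PartialOrder P] : Set (P × P) :=
  {p | p ∈ incPairs P ∧ IsMin p.1 ∧ IsMax p.2}

/-- A set of incomparable pairs is reversible if some linear extension `L` of the poset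
satisfies `x > y` in `L` for every pair `(x, y)` of the set. Here `L a b` means `a ≤ b` in `L`. -/
def IsReversible {P : Type*} [PartialOrder P] (I : Set (P × P)) : Prop :=
  I ⊆ incPairs P ∧
    ∃ L : P → P → Prop, IsLinearOrder P L ∧ (∀ x y, x ≤ y → L x y) ∧
      ∀ p ∈ I, L p.2 p.1 ∧ p.2 ≠ p.1

theorem isReversible_empty {P : Type*} [PartialOrder P] : IsReversible (∅ : Set (P × P)) := by
  obtain ⟨s, hs, hrs⟩ := extend_partialOrder ((· ≤ ·) : P → P → Prop)
  exact ⟨Set.empty_subset _, s, hs, hrs, by simp⟩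

theorem isReversible_singleton {P : Type*} [PartialOrder P] {p : P × P} (hp : p ∈ incPairs P) :
    IsReversible {p} := by
  obtain ⟨x, y⟩ := p
  obtain ⟨h1, h2⟩ : ¬ x ≤ y ∧ ¬ y ≤ x := hp
  have hr : IsPartialOrder P (fun a b => a ≤ b ∨ (a ≤ y ∧ x ≤ b)) :=
    { refl := fun a => Or.inl le_rfl
      trans := by
        rintro a b c (h | ⟨h, h'⟩) (k | ⟨k, k'⟩)
        · exact Or.inl (h.trans k)
        · exact Or.inr ⟨h.trans k, k'⟩
        · exact Or.inr ⟨h, h'.trans k⟩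
        · exact Or.inr ⟨h, k'⟩
      antisymm := by
        rintro a b (h | ⟨h, h'⟩) (k | ⟨k, k'⟩)
        · exact le_antisymm h k
        · exact absurd (k'.trans (h.trans k)) h1
        · exact absurd (h'.trans (k.trans h)) h1
        · exact absurd (h'.trans k) h1 }
  obtain ⟨s, hs, hrs⟩ := extend_partialOrder (fun a b => a ≤ b ∨ (a ≤ y ∧ x ≤ b))
  refine ⟨by rintro _ rfl; exact ⟨h1, h2⟩, s, hs, fun a b hab => hrs a b (Or.inl hab), ?_⟩
  rintro _ rfl
  exact ⟨hrs y x (Or.inr ⟨le_rfl, le_rfl⟩), fun h => h2 h.le⟩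

/-- The set of which `dim` takes the minimum is not empty. -/
theorem exists_reversible_cover {P : Type*} [PartialOrder P] [Finite P] {I : Set (P × P)}
    (hI : I ⊆ incPairs P) :
    ∃ d : ℕ, 1 ≤ d ∧ ∃ R : Fin d → Set (P × P), (∀ i, IsReversible (R i)) ∧ I ⊆ ⋃ i, R i := by
  rcases I.eq_empty_or_nonempty with rfl | ⟨p, hp⟩
  · exact ⟨1, le_rfl, fun _ => ∅, fun _ => isReversible_empty, by simp⟩
  · obtain ⟨d, ⟨e⟩⟩ := Finite.exists_equiv_fin I
    refine ⟨d, Fin.pos (e ⟨p, hp⟩), fun i => {(e.symm i : P × P)},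
      fun i => isReversible_singleton (hI (e.symm i).2), fun q hq => ?_⟩
    exact Set.mem_iUnion.2 ⟨e ⟨q, hq⟩, by simp⟩

/-- `dim(I)` for `I ⊆ Inc(P)`: the least `d ≥ 1` such that `I` can be covered by `d` reversible
sets. (For finite `P` and `I ⊆ Inc(P)` such a `d` exists, see `exists_reversible_cover`.) -/
noncomputable def dim {P : Type*} [PartialOrder P] (I : Set (P × P)) : ℕ :=
  sInf {d : ℕ | 1 ≤ d ∧
    ∃ R : Fin d → Set (P × P), (∀ i, IsReversible (R i)) ∧ I ⊆ ⋃ i, R i}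

/-- The height of a poset: the maximum number of elements in a chain. -/
noncomputable def posetHeight (P : Type*) [PartialOrder P] : ℕ∞ :=
  (Set.univ : Set P).chainHeight (· ≤ ·)

end PosetDim

/-! ### Plane drawings of graphs -/

/-- `A` is a simple polygonal arc in the plane `ℂ = ℝ²` with ends `p` and `q`: the union of the
segments of a polygonal line `c 0, c 1, …, c n` from `p` to `q` with nondegenerate segments, such
that consecutive segments share only their common end and other segments are disjoint. -/
def IsPolygonalArc (p q : ℂ) (A : Set ℂ) : Prop :=
  ∃ (n : ℕ) (c : ℕ → ℂ), 0 < n ∧ c 0 = p ∧ c n = q ∧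
    (∀ i < n, c i ≠ c (i + 1)) ∧
    (∀ i j, i < j → j < n → ∀ z ∈ segment ℝ (c i) (c (i + 1)),
      z ∈ segment ℝ (c j) (c (j + 1)) → j = i + 1 ∧ z = c j) ∧
    A = {z | ∃ i < n, z ∈ segment ℝ (c i) (c (i + 1))}

/-- A plane drawing of a graph (without edge crossings): vertices are distinct points of the
plane, the edge `uv` is an arc joining the points of `u` and `v`, the interior of an edge contains
no vertex and no point of another edge. (The values of `arc` off the edge set are irrelevant.) -/
structure PlaneDrawing {V : Type*} (G : SimpleGraph V) where
  point : V → ℂ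
  arc : Sym2 V → Set ℂ
  point_injective : Function.Injective point
  isPolygonalArc : ∀ u v, G.Adj u v → IsPolygonalArc (point u) (point v) (arc s(u, v))
  mem_of_point_mem : ∀ e ∈ G.edgeSet, ∀ w, point w ∈ arc e → w ∈ e
  inter_arc : ∀ e ∈ G.edgeSet, ∀ f ∈ G.edgeSet, e ≠ f → ∀ z ∈ arc e, z ∈ arc f →
    ∃ w, w ∈ e ∧ w ∈ f ∧ point w = z

namespace PlaneDrawing

variable {V : Type*} {G : SimpleGraph V}

/-- The subset of the plane covered by the drawing. -/
def support (D : PlaneDrawing G) : Set ℂ :=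
  Set.range D.point ∪ ⋃ e ∈ G.edgeSet, D.arc e

/-- The faces of a drawing: the connected components of its complement in the plane. -/
def IsFace (D : PlaneDrawing G) (F : Set ℂ) : Prop :=
  ∃ z ∈ D.supportᶜ, F = connectedComponentIn D.supportᶜ z

/-- The vertices `u` and `v` are on (the boundary of) a common face. -/
def OnSameFace (D : PlaneDrawing G) (u v : V) : Prop :=
  ∃ F, D.IsFace F ∧ D.point u ∈ closure F ∧ D.point v ∈ closure F

end PlaneDrawing

/-- A graph is planar if it has a plane drawing. -/
def IsPlanarGraph {V : Type*} (G : SimpleGraph V) : Prop :=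
  Nonempty (PlaneDrawing G)

/-! ### Doubly constrained and doubly exposed sets of pairs -/

namespace PosetDim

/-- The non-empty set `I ⊆ Inc(Min(P), Max(P))` is doubly constrained by `(x₀, y₀)`. -/
structure IsDoublyConstrainedBy {P : Type*} [PartialOrder P] (I : Set (P × P)) (x₀ y₀ : P) :
    Prop where
  nonempty : I.Nonempty
  subset_incMinMax : I ⊆ incMinMax P
  lt : x₀ < y₀
  lt_snd : ∀ p ∈ I, x₀ < p.2
  fst_lt : ∀ p ∈ I, p.1 < y₀

/-- `I` is doubly constrained in `P`. -/
def IsDoublyConstrained {P : Type*} [PartialOrder P] (I : Set (P × P)) : Prop :=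
  ∃ x₀ y₀ : P, IsDoublyConstrainedBy I x₀ y₀

/-- `I` is doubly exposed in `P`: it is doubly constrained by some `(x₀, y₀)`, and the cover graph
of `P` (`SimpleGraph.hasse P`) has a plane drawing with `x₀` and `y₀` on the same face. -/
def IsDoublyExposed {P : Type*} [PartialOrder P] (I : Set (P × P)) : Prop :=
  ∃ x₀ y₀ : P, IsDoublyConstrainedBy I x₀ y₀ ∧
    ∃ D : PlaneDrawing (SimpleGraph.hasse P), D.OnSameFace x₀ y₀

end PosetDim

/-!
The elements `x₀ < y₀` that constrain `I` are joined by a saturated chain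
`x₀ = z 0 ⋖ z 1 ⋖ ⋯ ⋖ z m = y₀`, of at most `h` elements. For a pair `(a, b)` of `I` let `z (i + 1)`
be the first element of the chain above `a`. Then `z (i + 1)` is not below `b`, so an upward path
from `x₀` to `b` leaves the chain for good at some `z j` with `j ≤ i`, and if `0 < j` it does so on
the left or on the right of the path `z 0, …, z (i + 1)` in the drawing. This sorts `I` into `2 m`
classes, `m ≤ h - 1`.

For a class, let `Q` be obtained by deleting the cover relations at `z 1, …, z i` that leave this
path on the other side (`Thinned`, `Keep`). Three things make `Q` suitable for the largest class.
* No first entry `a` of the class is below `z 1, …, z i`, so `a` keeps its upset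
  (`toThinned_le_of_not_le`). In particular `a` stays below `z (i + 1)`, and a set of pairs of the
  class that is reversible in `Q` is reversible in `P` (`isReversible_of_image`).
* The path from `x₀` to `b` survives, by the choice of the side (`exists_toThinned_le`).
* The face of the remaining drawing along the cleared side of the path has `z 0` and `z (i + 1)` on
  its boundary (`exists_drawing_onSameFace`).

For the last point the drawing is regarded as a system of straight segments that meet only at their
ends (`IsSegmentSystem`). A thin strip along the right-hand side of a segment lies in one face
(`exists_rightOf`), and at a common end of consecutive segments the strips are joined by the sector
between them, if no other segment enters it (`RightOf.turn`). The left-hand side of a path is the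
right-hand side of the reversed path.
-/

/-! ### Sectors -/

namespace PlaneTopology

open Set Filter Topology Complex

/-- The open sector swept out when the ray in direction `u` is turned counterclockwise onto the
ray in direction `w`. It is empty if `w` is a nonnegative multiple of `u`. -/
def sector (u w : ℂ) : Set ℂ :=
  {z | ∃ θ ∈ Ioo 0 (2 * Real.pi), ∃ l : ℝ, 0 < l ∧ w = l * exp (θ * I) * u ∧
    ∃ t ∈ Ioo 0 θ, ∃ ρ : ℝ, 0 < ρ ∧ z = ρ * exp (t * I) * u}

theorem eq_add_of_polar_eq {ρ ρ' t t' : ℝ} (hρ : 0 < ρ) (hρ' : 0 < ρ')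
    (h : (ρ : ℂ) * exp (t * I) = ρ' * exp (t' * I)) : ∃ k : ℤ, t = t' + k * (2 * Real.pi) := by
  have hn := congrArg norm h
  rw [norm_mul, norm_mul, norm_exp_ofReal_mul_I, norm_exp_ofReal_mul_I, norm_real, norm_real,
    Real.norm_of_nonneg hρ.le, Real.norm_of_nonneg hρ'.le, mul_one, mul_one] at hn
  subst hn
  have h0 : (ρ : ℂ) ≠ 0 := by exact_mod_cast hρ.ne'
  obtain ⟨k, hk⟩ := exp_eq_exp_iff_exists_int.1 (mul_left_cancel₀ h0 h)
  refine ⟨k, ?_⟩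
  have := congrArg im hk
  simpa using this

/-- There is no integral multiple of `2π` strictly between `-2π` and `0`. -/
theorem int_mul_two_pi_false {k : ℤ} (h1 : -(2 * Real.pi) < k * (2 * Real.pi))
    (h2 : k * (2 * Real.pi) < 0) : False := by
  have hpi : 0 < 2 * Real.pi := Real.two_pi_pos
  have h3 : (k : ℝ) < 0 := by
    by_contra hk
    exact absurd (mul_nonneg (not_lt.1 hk) hpi.le) (not_le.2 h2)
  have h4 : (-1 : ℝ) < k := by
    by_contra hk
    have := mul_le_mul_of_nonneg_right (not_lt.1 hk) hpi.le
    linarith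
  have h5 : k < 0 := by exact_mod_cast h3
  have h6 : -1 < k := by exact_mod_cast h4
  omega

theorem ne_zero_of_mem_sector {u w z : ℂ} (hu : u ≠ 0) (hz : z ∈ sector u w) : z ≠ 0 := by
  obtain ⟨θ, hθ, l, hl, hw, t, ht, ρ, hρ, rfl⟩ := hz
  have h0 : (ρ : ℂ) ≠ 0 := by exact_mod_cast hρ.ne'
  exact mul_ne_zero (mul_ne_zero h0 (exp_ne_zero _)) hu

theorem smul_mem_sector {u w z : ℂ} {s : ℝ} (hs : 0 < s) (hz : (s : ℂ) * z ∈ sector u w) :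
    z ∈ sector u w := by
  obtain ⟨θ, hθ, l, hl, hw, t, ht, ρ, hρ, h⟩ := hz
  refine ⟨θ, hθ, l, hl, hw, t, ht, ρ / s, by positivity, ?_⟩
  have h0 : (s : ℂ) ≠ 0 := by exact_mod_cast hs.ne'
  push_cast
  field_simp
  linear_combination h

theorem left_notMem_sector {u : ℂ} (w : ℂ) (hu : u ≠ 0) : u ∉ sector u w := by
  rintro ⟨θ, hθ, l, hl, hw, t, ht, ρ, hρ, h⟩
  have h1 : ((1 : ℝ) : ℂ) * exp ((0 : ℝ) * I) = ρ * exp (t * I) :=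
    mul_right_cancel₀ hu (by simpa using h)
  obtain ⟨k, hk⟩ := eq_add_of_polar_eq one_pos hρ h1
  exact int_mul_two_pi_false (k := k) (by linarith [ht.1, ht.2, hθ.2]) (by linarith [ht.1])

theorem right_notMem_sector {u : ℂ} (w : ℂ) (hu : u ≠ 0) : w ∉ sector u w := by
  rintro ⟨θ, hθ, l, hl, hw, t, ht, ρ, hρ, h⟩
  obtain ⟨k, hk⟩ := eq_add_of_polar_eq hρ hl (mul_right_cancel₀ hu (h.symm.trans hw))
  exact int_mul_two_pi_false (k := k) (by linarith [ht.1, ht.2, hθ.2]) (by linarith [ht.2])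

/-- The two sectors bounded by the rays in directions `u` and `w` are disjoint. -/
theorem notMem_sector_swap {u w z : ℂ} (hu : u ≠ 0) (hz : z ∈ sector u w) : z ∉ sector w u := by
  obtain ⟨θ, hθ, l, hl, hw, t, ht, ρ, hρ, h⟩ := hz
  rintro ⟨θ', hθ', l', hl', hu', t', ht', ρ', hρ', h'⟩
  have h1 : ((1 : ℝ) : ℂ) * exp ((0 : ℝ) * I) = (l' * l : ℝ) * exp ((θ' + θ : ℝ) * I) := by
    refine mul_right_cancel₀ hu ?_
    push_cast
    rw [add_mul, exp_add, zero_mul, exp_zero]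
    linear_combination hu' + l' * exp (θ' * I) * hw
  have h2 : (ρ : ℂ) * exp (t * I) = (ρ' * l : ℝ) * exp ((t' + θ : ℝ) * I) := by
    refine mul_right_cancel₀ hu ?_
    push_cast
    rw [add_mul, exp_add]
    linear_combination h' - h + ρ' * exp (t' * I) * hw
  obtain ⟨k, hk⟩ := eq_add_of_polar_eq one_pos (by positivity) h1
  obtain ⟨j, hj⟩ := eq_add_of_polar_eq hρ (by positivity) h2
  have hpi := Real.two_pi_pos
  have hk1 : k = -1 := by
    have h3 : (k : ℝ) < 0 := by
      by_contra hk0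
      have := mul_nonneg (not_lt.1 hk0) hpi.le
      linarith [hθ.1, hθ'.1]
    have h4 : (-2 : ℝ) < k := by
      by_contra hk0
      have := mul_le_mul_of_nonneg_right (not_lt.1 hk0) hpi.le
      linarith [hθ.2, hθ'.2]
    have h5 : k < 0 := by exact_mod_cast h3
    have h6 : -2 < k := by exact_mod_cast h4
    omega
  subst hk1
  push_cast at hk
  exact int_mul_two_pi_false (k := j) (by linarith [ht.1, ht'.2]) (by linarith [ht.2, ht'.1])

theorem exists_angle {u w : ℂ} (hu : u ≠ 0) (hw : w ≠ 0) (h : ∀ l : ℝ, 0 < l → w ≠ l * u) :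
    ∃ θ ∈ Ioo 0 (2 * Real.pi), ∃ l : ℝ, 0 < l ∧ w = l * exp (θ * I) * u := by
  have hn : 0 < ‖w / u‖ := norm_pos_iff.2 (div_ne_zero hw hu)
  have hq : w = ‖w / u‖ * exp (arg (w / u) * I) * u := by
    rw [norm_mul_exp_arg_mul_I, div_mul_cancel₀ _ hu]
  have hpi := Real.pi_pos
  rcases lt_trichotomy (arg (w / u)) 0 with h0 | h0 | h0
  · refine ⟨arg (w / u) + 2 * Real.pi,
      ⟨by linarith [neg_pi_lt_arg (w / u)], by linarith⟩, _, hn, ?_⟩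
    push_cast
    rw [add_mul, exp_add, exp_two_pi_mul_I, mul_one]
    exact hq
  · exact absurd (by simpa [h0] using hq) (h _ hn)
  · exact ⟨_, ⟨h0, by linarith [arg_le_pi (w / u)]⟩, _, hn, hq⟩

/-! ### The right-hand side of a segment -/

/-- `F` contains the right-hand germ at every interior point of the segment from `x` to `y`. -/
def RightOf (F : Set ℂ) (x y : ℂ) : Prop :=
  ∀ s ∈ Ioo (0 : ℝ) 1, ∀ᶠ τ : ℝ in 𝓝[>] 0, x + (s - τ * I) * (y - x) ∈ F

theorem RightOf.mono {F F' : Set ℂ} {x y : ℂ} (h : RightOf F x y) (hF : F ⊆ F') :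
    RightOf F' x y := fun s hs => (h s hs).mono fun _ hτ => hF hτ

theorem RightOf.mem_closure {F : Set ℂ} {x y : ℂ} (h : RightOf F x y) :
    x ∈ closure F ∧ y ∈ closure F := by
  have key : ∀ s ∈ Ioo (0 : ℝ) 1, x + s * (y - x) ∈ closure F := by
    intro s hs
    have hc : Continuous fun τ : ℝ => x + (s - τ * I) * (y - x) := by fun_prop
    have ht : Tendsto (fun τ : ℝ => x + (s - τ * I) * (y - x)) (𝓝[>] 0)
        (𝓝 (x + s * (y - x))) := by
      have := (hc.tendsto 0).mono_left (nhdsWithin_le_nhds (s := Ioi 0))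
      simpa using this
    exact mem_closure_of_tendsto ht (h s hs)
  have hc : Continuous fun s : ℝ => x + s * (y - x) := by fun_prop
  have himg : ∀ s ∈ Icc (0 : ℝ) 1, x + s * (y - x) ∈ closure F := by
    intro s hs
    rw [← closure_Ioo zero_ne_one] at hs
    have := map_mem_closure hc hs (t := closure F) key
    rwa [closure_closure] at this
  exact ⟨by simpa using himg 0 (by simp), by simpa using himg 1 (by simp)⟩

/-- A strip along the right-hand side of a segment of a closed set `S`, thinner than the distance
to the rest `Z` of `S`, is connected and avoids `S`. -/
theorem exists_rightOf {S Z : Set ℂ} {x y : ℂ} (hxy : x ≠ y) (hZ : IsClosed Z)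
    (hSZ : S ⊆ Z ∪ segment ℝ x y) (hd : Disjoint Z (openSegment ℝ x y)) :
    ∃ z ∈ Sᶜ, RightOf (connectedComponentIn Sᶜ z) x y := by
  have hdir : y - x ≠ 0 := sub_ne_zero.2 hxy.symm
  have hdn : 0 < ‖y - x‖ := norm_pos_iff.2 hdir
  -- Adding the point `x` to `Z` makes it nonempty, so that `infDist` has its usual meaning.
  set Z' := insert x Z with hZ'
  have hZ'c : IsClosed Z' := isClosed_singleton.union hZ
  have hne : Z'.Nonempty := ⟨x, mem_insert _ _⟩
  set ε : ℝ → ℝ := fun s => Metric.infDist (x + s * (y - x)) Z' / ‖y - x‖ with hε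
  have hεc : Continuous ε := by
    have : Continuous fun s : ℝ => x + s * (y - x) := by fun_prop
    exact ((Metric.continuous_infDist_pt _).comp this).div_const _
  have hεpos : ∀ s ∈ Ioo (0 : ℝ) 1, 0 < ε s := by
    intro s hs
    refine div_pos ((hZ'c.notMem_iff_infDist_pos hne).1 ?_) hdn
    rintro (h | h)
    · have : (s : ℂ) * (y - x) = 0 := by linear_combination h
      rcases mul_eq_zero.1 this with h | h
      · exact hs.1.ne' (by exact_mod_cast h)
      · exact hdir h
    · refine disjoint_left.1 hd h ?_
      rw [openSegment_eq_image']
      exact ⟨s, hs, by simp⟩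
  set f : ℝ × ℝ → ℂ := fun q => x + (q.1 - (q.2 * ε q.1 : ℝ) * I) * (y - x) with hf
  have hfc : Continuous f := by fun_prop
  have hfS : ∀ q ∈ Ioo (0 : ℝ) 1 ×ˢ Ioo (0 : ℝ) 1, f q ∈ Sᶜ := by
    rintro ⟨s, τ⟩ ⟨hs, hτ⟩ hS
    have he := hεpos s hs
    rcases hSZ hS with h | h
    · have h1 := Metric.infDist_le_dist_of_mem (x := x + s * (y - x)) (mem_insert_of_mem x h)
      have h2 : dist (x + s * (y - x)) (f (s, τ)) = τ * ε s * ‖y - x‖ := by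
        have : x + s * (y - x) - f (s, τ) = (τ * ε s : ℝ) * I * (y - x) := by
          simp only [hf]; ring
        rw [dist_eq_norm, this, norm_mul, norm_mul, norm_I, norm_real,
          Real.norm_of_nonneg (mul_pos hτ.1 he).le, mul_one]
      have h3 : Metric.infDist (x + s * (y - x)) Z' = ε s * ‖y - x‖ := by
        simp only [hε]; field_simp
      rw [h2, ← hZ', h3] at h1
      have h4 : τ * (ε s * ‖y - x‖) < 1 * (ε s * ‖y - x‖) :=
        mul_lt_mul_of_pos_right hτ.2 (mul_pos he hdn)
      linarith
    · rw [segment_eq_image'] at h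
      obtain ⟨s', -, h'⟩ := h
      have h1 : (s' : ℂ) = s - (τ * ε s : ℝ) * I := by
        refine mul_right_cancel₀ hdir ?_
        simp only [hf, real_smul] at h'
        linear_combination h'
      have h2 := congrArg im h1
      simp only [sub_im, ofReal_im, mul_im, ofReal_re, I_im, I_re] at h2
      have := mul_pos hτ.1 he
      linarith
  have hconn : IsPreconnected (f '' (Ioo (0 : ℝ) 1 ×ˢ Ioo (0 : ℝ) 1)) :=
    (isPreconnected_Ioo.prod isPreconnected_Ioo).image f hfc.continuousOn
  have hmem : ((1 / 2, 1 / 2) : ℝ × ℝ) ∈ Ioo (0 : ℝ) 1 ×ˢ Ioo (0 : ℝ) 1 := by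
    constructor <;> constructor <;> norm_num
  refine ⟨f (1 / 2, 1 / 2), hfS _ hmem, ?_⟩
  have hsub : f '' (Ioo (0 : ℝ) 1 ×ˢ Ioo (0 : ℝ) 1) ⊆
      connectedComponentIn Sᶜ (f (1 / 2, 1 / 2)) :=
    hconn.subset_connectedComponentIn (mem_image_of_mem f hmem) (image_subset_iff.2 hfS)
  refine RightOf.mono (fun s hs => ?_) hsub
  have he := hεpos s hs
  filter_upwards [Ioo_mem_nhdsGT he] with τ hτ
  refine ⟨(s, τ / ε s), ⟨hs, div_pos hτ.1 he, (div_lt_one he).2 hτ.2⟩, ?_⟩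
  simp only [hf, div_mul_cancel₀ _ he.ne']

theorem eventually_arg_mem {δ θ r : ℝ} (hδ : 0 < δ) (hθ : 0 < θ) (hr : δ < r) :
    ∀ᶠ τ : ℝ in 𝓝[>] 0, arg (δ + τ * I) ∈ Ioo 0 θ ∧ ‖(δ + τ * I : ℂ)‖ ∈ Ioo 0 r := by
  have hc : Continuous fun τ : ℝ => (δ + τ * I : ℂ) := by fun_prop
  have h0 : Tendsto (fun τ : ℝ => (δ + τ * I : ℂ)) (𝓝[>] 0) (𝓝 (δ : ℂ)) := by
    have := (hc.tendsto 0).mono_left (nhdsWithin_le_nhds (s := Ioi 0))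
    simpa using this
  have h1 : Tendsto (fun τ : ℝ => arg (δ + τ * I)) (𝓝[>] 0) (𝓝 0) := by
    have h := (continuousAt_arg (x := (δ : ℂ)) (Or.inl (by simpa using hδ))).tendsto.comp h0
    rwa [arg_ofReal_of_nonneg hδ.le] at h
  have h2 := h0.norm
  rw [norm_real, Real.norm_of_nonneg hδ.le] at h2
  filter_upwards [h1.eventually_lt_const hθ, h2.eventually_lt_const hr, self_mem_nhdsWithin]
    with τ ha hb hτ
  have him : 0 < (δ + τ * I : ℂ).im := by simpa using hτ
  refine ⟨⟨lt_of_le_of_ne (arg_nonneg_iff.2 him.le) fun h => ?_, ha⟩,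
    norm_pos_iff.2 fun h => ?_, hb⟩
  · exact him.ne' (arg_eq_zero_iff.1 h.symm).2
  · rw [h] at him; simp at him

/-- A face on the right of the segment from `x` to `y` is also on the right of the segment from
`y` to `w` if the complement contains the sector at `y` between these segments. -/
theorem RightOf.turn {S F Z : Set ℂ} {x y w z : ℂ} (hxy : x ≠ y) (hyw : y ≠ w)
    (hF : F = connectedComponentIn Sᶜ z) (h : RightOf F x y)
    (hZ : IsClosed Z) (hSZ : S ⊆ Z ∪ segment ℝ y w) (hd : Disjoint Z (openSegment ℝ y w))
    (hpar : ∀ l : ℝ, 0 < l → w - y ≠ l * (x - y)) {r : ℝ} (hr : 0 < r)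
    (hfree : ∀ v ∈ sector (x - y) (w - y), ‖v‖ < r → y + v ∉ S) : RightOf F y w := by
  obtain ⟨z', -, h'⟩ := exists_rightOf hyw hZ hSZ hd
  have hu : x - y ≠ 0 := sub_ne_zero.2 hxy
  have hun : 0 < ‖x - y‖ := norm_pos_iff.2 hu
  obtain ⟨θ, hθ, l, hl, hw⟩ := exists_angle hu (sub_ne_zero.2 hyw.symm) hpar
  set r' := r / ‖x - y‖ with hr'
  have hr'0 : 0 < r' := div_pos hr hun
  set g : ℝ × ℝ → ℂ := fun q => y + q.1 * exp (q.2 * I) * (x - y) with hg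
  have hgc : Continuous g := by fun_prop
  have hconn : IsPreconnected (g '' (Ioo 0 r' ×ˢ Ioo 0 θ)) :=
    (isPreconnected_Ioo.prod isPreconnected_Ioo).image g hgc.continuousOn
  have hsub : g '' (Ioo 0 r' ×ˢ Ioo 0 θ) ⊆ Sᶜ := by
    rintro _ ⟨⟨ρ, t⟩, ⟨hρ, ht⟩, rfl⟩
    refine hfree _ ⟨θ, hθ, l, hl, hw, t, ht, ρ, hρ.1, rfl⟩ ?_
    rw [norm_mul, norm_mul, norm_exp_ofReal_mul_I, norm_real, Real.norm_of_nonneg hρ.1.le, mul_one]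
    exact (lt_div_iff₀ hun).1 hρ.2
  -- The sector meets the strip along the first segment, at points of small angle.
  have hmeet : ∃ p ∈ g '' (Ioo 0 r' ×ˢ Ioo 0 θ), p ∈ F := by
    obtain ⟨δ, hδ0, hδ⟩ := exists_between (lt_min hr'0 one_pos)
    obtain ⟨τ, h1, h2⟩ := ((eventually_arg_mem hδ0 hθ.1 (hδ.trans_le (min_le_left _ _))).and
      (h (1 - δ) ⟨by linarith [min_le_right r' 1], by linarith⟩)).exists
    refine ⟨_, ⟨(‖(δ + τ * I : ℂ)‖, arg (δ + τ * I)), ⟨h1.2, h1.1⟩, rfl⟩, ?_⟩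
    convert h2 using 1
    simp only [hg, norm_mul_exp_arg_mul_I]
    push_cast
    ring
  -- It meets the strip along the second segment, at points of angle just below `θ`.
  have hmeet' : ∃ p ∈ g '' (Ioo 0 r' ×ˢ Ioo 0 θ), p ∈ connectedComponentIn Sᶜ z' := by
    obtain ⟨δ, hδ0, hδ⟩ := exists_between (lt_min (div_pos hr'0 hl) one_pos)
    obtain ⟨τ, h1, h2⟩ := ((eventually_arg_mem hδ0 hθ.1 (hδ.trans_le (min_le_left _ _))).and
      (h' δ ⟨hδ0, hδ.trans_le (min_le_right _ _)⟩)).exists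
    refine ⟨_, ⟨(l * ‖(δ + τ * I : ℂ)‖, θ - arg (δ + τ * I)), ⟨⟨mul_pos hl h1.2.1, ?_⟩,
      by linarith [h1.1.2], by linarith [h1.1.1]⟩, rfl⟩, ?_⟩
    · have := (lt_div_iff₀ hl).1 h1.2.2
      linarith
    · convert h2 using 1
      have h3 : (‖(δ + τ * I : ℂ)‖ : ℂ) * exp (-(arg (δ + τ * I) * I)) = δ - τ * I := by
        have h4 := congrArg (starRingEnd ℂ) (norm_mul_exp_arg_mul_I (δ + τ * I))
        rw [map_mul, ← exp_conj, map_mul, conj_ofReal, conj_ofReal, conj_I, map_add, map_mul,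
          conj_ofReal, conj_ofReal, conj_I] at h4
        rw [← mul_neg, h4]; ring
      simp only [hg]
      rw [hw, ← h3]
      push_cast
      rw [sub_mul, sub_eq_add_neg, exp_add]
      ring
  obtain ⟨p, hp, hpF⟩ := hmeet
  obtain ⟨p', hp', hpF'⟩ := hmeet'
  have e1 : connectedComponentIn Sᶜ z = connectedComponentIn Sᶜ p :=
    connectedComponentIn_eq (hF ▸ hpF)
  have e2 : connectedComponentIn Sᶜ z' = connectedComponentIn Sᶜ p' :=
    connectedComponentIn_eq hpF'
  have e3 : connectedComponentIn Sᶜ p = connectedComponentIn Sᶜ p' :=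
    connectedComponentIn_eq (hconn.subset_connectedComponentIn hp hsub hp')
  rw [hF, e1, e3, ← e2]
  exact h'

end PlaneTopology

/-! ### Systems of segments -/

namespace PlaneTopology

open Set Filter Topology Complex

/-- A finite set `W` of points and a finite set `E` of segments of the plane, each segment
recorded with both orientations, such that the points of `W` are not inside segments and two
segments share at most a common end. -/
structure IsSegmentSystem (W : Set ℂ) (E : Set (ℂ × ℂ)) : Prop where
  finite_points : W.Finite
  finite_segments : E.Finite
  ne : ∀ x y, (x, y) ∈ E → x ≠ y
  symm : ∀ x y, (x, y) ∈ E → (y, x) ∈ E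
  inter : ∀ x y x' y' z, (x, y) ∈ E → (x', y') ∈ E → z ∈ segment ℝ x y → z ∈ segment ℝ x' y' →
    (x' = x ∧ y' = y) ∨ (x' = y ∧ y' = x) ∨ ((z = x ∨ z = y) ∧ (z = x' ∨ z = y'))
  point : ∀ x y, (x, y) ∈ E → ∀ w ∈ W, w ∈ segment ℝ x y → w = x ∨ w = y

/-- The subset of the plane covered by a system of segments. -/
def segmentSupport (W : Set ℂ) (E : Set (ℂ × ℂ)) : Set ℂ :=
  W ∪ ⋃ e ∈ E, segment ℝ e.1 e.2

theorem isClosed_segment (x y : ℂ) : IsClosed (segment ℝ x y) := by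
  rw [← convexHull_pair]
  exact ((Set.toFinite {x, y}).isCompact_convexHull (𝕜 := ℝ)).isClosed

theorem isClosed_union_segments {W : Set ℂ} {E : Set (ℂ × ℂ)} (hW : W.Finite) (hE : E.Finite) :
    IsClosed (segmentSupport W E) :=
  hW.isClosed.union (hE.isClosed_biUnion fun e _ => isClosed_segment e.1 e.2)

namespace IsSegmentSystem

variable {W : Set ℂ} {E : Set (ℂ × ℂ)}

theorem notMem_openSegment (x y : ℂ) (hxy : x ≠ y) :
    x ∉ openSegment ℝ x y ∧ y ∉ openSegment ℝ x y :=
  ⟨fun h => hxy (left_mem_openSegment_iff.1 h), fun h => hxy (right_mem_openSegment_iff.1 h)⟩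

/-- What a system covers besides a given segment is contained in a closed set disjoint from the
interior of that segment. -/
theorem exists_rest (hE : IsSegmentSystem W E) {x y : ℂ} (h : (x, y) ∈ E) :
    ∃ Z, IsClosed Z ∧ segmentSupport W E ⊆ Z ∪ segment ℝ x y ∧
      Disjoint Z (openSegment ℝ x y) := by
  have hxy := hE.ne x y h
  refine ⟨segmentSupport W {e ∈ E | ¬ (e.1 = x ∧ e.2 = y) ∧ ¬ (e.1 = y ∧ e.2 = x)},
    isClosed_union_segments hE.finite_points (hE.finite_segments.subset fun e he => he.1), ?_, ?_⟩
  · rintro z (hz | hz)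
    · exact Or.inl (Or.inl hz)
    · obtain ⟨⟨a, b⟩, he, hz⟩ := mem_iUnion₂.1 hz
      by_cases h1 : a = x ∧ b = y
      · obtain ⟨rfl, rfl⟩ := h1
        exact Or.inr hz
      by_cases h2 : a = y ∧ b = x
      · obtain ⟨rfl, rfl⟩ := h2
        exact Or.inr (segment_symm ℝ a b ▸ hz)
      exact Or.inl (Or.inr (mem_iUnion₂.2 ⟨(a, b), ⟨he, h1, h2⟩, hz⟩))
  · refine disjoint_left.2 fun z hz hzo => ?_
    have hzs := openSegment_subset_segment ℝ x y hzo
    have hends : ¬ (z = x ∨ z = y) := by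
      rintro (rfl | rfl)
      · exact (notMem_openSegment _ _ hxy).1 hzo
      · exact (notMem_openSegment _ _ hxy).2 hzo
    rcases hz with hz | hz
    · exact hends (hE.point x y h z hz hzs)
    · obtain ⟨⟨a, b⟩, ⟨he, h1, h2⟩, hz⟩ := mem_iUnion₂.1 hz
      rcases hE.inter x y a b z h he hzs hz with h3 | h3 | h3
      · exact h1 h3
      · exact h2 h3
      · exact hends h3.1

/-- Near an end `y` of a segment, the system consists of the segments with end `y`. Hence a sector
at `y` that no such segment enters is free of the system near `y`. -/
theorem exists_free_sector (hE : IsSegmentSystem W E) {x y w : ℂ} (h : (x, y) ∈ E)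
    (hsec : ∀ t, (y, t) ∈ E → t - y ∉ sector (x - y) (w - y)) :
    ∃ r > 0, ∀ v ∈ sector (x - y) (w - y), ‖v‖ < r → y + v ∉ segmentSupport W E := by
  have hu : x - y ≠ 0 := sub_ne_zero.2 (hE.ne x y h)
  set Z := segmentSupport (W \ {y}) {e ∈ E | y ∉ segment ℝ e.1 e.2} with hZdef
  have hZ : IsClosed Z := isClosed_union_segments (hE.finite_points.subset sdiff_subset)
    (hE.finite_segments.subset fun e he => he.1)
  have hyZ : y ∈ Zᶜ := by
    rintro (hy | hy)
    · exact hy.2 rfl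
    · obtain ⟨e, he, hy⟩ := mem_iUnion₂.1 hy
      exact he.2 hy
  obtain ⟨r, hr, hball⟩ := Metric.isOpen_iff.1 hZ.isOpen_compl y hyZ
  refine ⟨r, hr, fun v hv hvr hmem => ?_⟩
  have hv0 := ne_zero_of_mem_sector hu hv
  have hvZ : y + v ∉ Z := hball (by simpa [dist_eq_norm] using hvr)
  have hray : ∀ t, (y, t) ∈ E → y + v ∉ segment ℝ y t := by
    intro t ht hseg
    rw [segment_eq_image'] at hseg
    obtain ⟨s, hs, hst⟩ := hseg
    have hst' : (s : ℂ) * (t - y) = v := by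
      rw [← real_smul]
      exact add_left_cancel hst
    have hs0 : 0 < s := by
      refine lt_of_le_of_ne hs.1 fun h0 => hv0 ?_
      rw [← hst', ← h0]; simp
    exact hsec t ht (smul_mem_sector hs0 (hst'.symm ▸ hv))
  rcases hmem with hmem | hmem
  · exact hvZ (Or.inl ⟨hmem, fun h0 => hv0 (by simpa using h0)⟩)
  · obtain ⟨⟨a, b⟩, he, hab⟩ := mem_iUnion₂.1 hmem
    have hy : y ∈ segment ℝ a b := by
      by_contra hy
      exact hvZ (Or.inr (mem_iUnion₂.2 ⟨(a, b), ⟨he, hy⟩, hab⟩))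
    have hend : y = a ∨ y = b := by
      rcases hE.inter x y a b y h he (right_mem_segment ℝ x y) hy with h1 | h1 | h1
      · exact Or.inr h1.2.symm
      · exact Or.inl h1.1.symm
      · exact h1.2
    rcases hend with rfl | rfl
    · exact hray b he hab
    · exact hray a (hE.symm _ _ he) (by rwa [segment_symm])

theorem ne_mul_sub (hE : IsSegmentSystem W E) {x y w : ℂ} (h : (x, y) ∈ E) (h' : (y, w) ∈ E)
    (hxw : x ≠ w) (l : ℝ) (hl : 0 < l) : w - y ≠ l * (x - y) := by
  intro heq
  have hu : x - y ≠ 0 := sub_ne_zero.2 (hE.ne x y h)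
  set m := min 1 l⁻¹ with hm
  have hm0 : 0 < m := lt_min one_pos (inv_pos.2 hl)
  -- The point `y + min(l, 1) (x - y)` lies on both segments.
  set q := y + (m : ℂ) * (w - y) with hq
  have hq1 : q ∈ segment ℝ y w := by
    rw [segment_eq_image']
    exact ⟨m, ⟨hm0.le, min_le_left _ _⟩, by simp [hq]⟩
  have hq2 : q ∈ segment ℝ x y := by
    rw [segment_symm, segment_eq_image']
    refine ⟨m * l, ⟨by positivity, ?_⟩, ?_⟩
    · calc m * l ≤ l⁻¹ * l := mul_le_mul_of_nonneg_right (min_le_right _ _) hl.le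
        _ = 1 := inv_mul_cancel₀ hl.ne'
    · simp only [hq, heq, real_smul]
      push_cast; ring
  have hqy : q ≠ y := by
    intro h0
    have h1 : (m : ℂ) * (w - y) = 0 := by linear_combination h0
    rcases mul_eq_zero.1 h1 with h1 | h1
    · exact hm0.ne' (by exact_mod_cast h1)
    · exact hE.ne y w h' (by linear_combination -h1)
  rcases hE.inter x y y w q h h' hq2 hq1 with h1 | h1 | ⟨h1, h2⟩
  · exact hE.ne x y h h1.1.symm
  · exact hxw h1.2.symm
  · exact hxw ((h1.resolve_right hqy).symm.trans (h2.resolve_left hqy))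

theorem exists_rightOf (hE : IsSegmentSystem W E) {x y : ℂ} (h : (x, y) ∈ E) :
    ∃ z ∈ (segmentSupport W E)ᶜ,
      RightOf (connectedComponentIn (segmentSupport W E)ᶜ z) x y := by
  obtain ⟨Z, hZ, hS, hd⟩ := hE.exists_rest h
  exact PlaneTopology.exists_rightOf (hE.ne x y h) hZ hS hd

/-- A face stays on the right when turning from one segment into the next, if no segment enters
the sector on the right-hand side between them. -/
theorem rightOf_turn (hE : IsSegmentSystem W E) {x y w z : ℂ} {F : Set ℂ}
    (hF : F = connectedComponentIn (segmentSupport W E)ᶜ z)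
    (hxy : (x, y) ∈ E) (hyw : (y, w) ∈ E) (hxw : x ≠ w)
    (hsec : ∀ t, (y, t) ∈ E → t - y ∉ sector (x - y) (w - y)) (h : RightOf F x y) :
    RightOf F y w := by
  obtain ⟨Z, hZ, hS, hd⟩ := hE.exists_rest hyw
  obtain ⟨r, hr, hfree⟩ := hE.exists_free_sector hxy hsec
  exact h.turn (hE.ne x y hxy) (hE.ne y w hyw) hF hZ hS hd (hE.ne_mul_sub hxy hyw hxw) hr hfree

end IsSegmentSystem

end PlaneTopology

/-! ### Drawings as systems of segments -/

/-- The polygonal line `c 0, …, c n` is a simple arc from `p` to `q` that covers `A`. -/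
structure IsPolyline (p q : ℂ) (A : Set ℂ) (n : ℕ) (c : ℕ → ℂ) : Prop where
  pos : 0 < n
  zero : c 0 = p
  last : c n = q
  ne : ∀ i < n, c i ≠ c (i + 1)
  simple : ∀ i j, i < j → j < n → ∀ z ∈ segment ℝ (c i) (c (i + 1)),
    z ∈ segment ℝ (c j) (c (j + 1)) → j = i + 1 ∧ z = c j
  eq : A = {z | ∃ i < n, z ∈ segment ℝ (c i) (c (i + 1))}

namespace IsPolyline

variable {p q : ℂ} {A : Set ℂ} {n : ℕ} {c : ℕ → ℂ}

theorem ne_of_lt (h : IsPolyline p q A n c) {i j : ℕ} (hij : i < j) (hj : j ≤ n) : c i ≠ c j := by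
  obtain ⟨k, rfl⟩ : ∃ k, j = k + 1 := ⟨j - 1, by omega⟩
  rcases Nat.lt_succ_iff_lt_or_eq.1 hij with hik | rfl
  · intro heq
    have := (h.simple i k hik (by omega) (c i) (left_mem_segment _ _ _)
      (heq ▸ right_mem_segment _ _ _)).2
    exact h.ne k (by omega) (this.symm.trans heq)
  · exact h.ne i (by omega)

theorem injOn (h : IsPolyline p q A n c) {i j : ℕ} (hi : i ≤ n) (hj : j ≤ n) (hc : c i = c j) :
    i = j := by
  rcases lt_trichotomy i j with hij | hij | hij
  · exact absurd hc (h.ne_of_lt hij hj)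
  · exact hij
  · exact absurd hc.symm (h.ne_of_lt hij hi)

theorem mem (h : IsPolyline p q A n c) {i : ℕ} (hi : i ≤ n) : c i ∈ A := by
  rw [h.eq]
  rcases hi.lt_or_eq with hi | rfl
  · exact ⟨i, hi, left_mem_segment _ _ _⟩
  · refine ⟨i - 1, Nat.sub_lt h.pos one_pos, ?_⟩
    rw [Nat.sub_add_cancel (show 1 ≤ i from h.pos)]
    exact right_mem_segment _ _ _

theorem segment_subset (h : IsPolyline p q A n c) {i : ℕ} (hi : i < n) :
    segment ℝ (c i) (c (i + 1)) ⊆ A := fun _ hz => h.eq ▸ ⟨i, hi, hz⟩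

theorem reverse (h : IsPolyline p q A n c) : IsPolyline q p A n (fun k => c (n - k)) := by
  have hseg : ∀ i, i < n → segment ℝ (c (n - i)) (c (n - (i + 1))) =
      segment ℝ (c (n - 1 - i)) (c (n - 1 - i + 1)) := by
    intro i hi
    rw [segment_symm, show n - (i + 1) = n - 1 - i by omega, show n - i = n - 1 - i + 1 by omega]
  refine ⟨h.pos, by simp [h.last], by simp [h.zero], fun i hi => ?_, ?_, ?_⟩
  · have := h.ne (n - 1 - i) (by omega)
    rw [show n - 1 - i + 1 = n - i by omega] at this
    rw [show n - (i + 1) = n - 1 - i by omega]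
    exact this.symm
  · intro i j hij hj z hz hz'
    rw [hseg i (by omega)] at hz
    rw [hseg j hj] at hz'
    obtain ⟨h1, h2⟩ := h.simple (n - 1 - j) (n - 1 - i) (by omega) (by omega) z hz' hz
    refine ⟨by omega, ?_⟩
    rw [h2, show n - 1 - i = n - j by omega]
  · rw [h.eq]
    ext z
    constructor
    · rintro ⟨i, hi, hz⟩
      refine ⟨n - 1 - i, by omega, ?_⟩
      rw [hseg _ (by omega), show n - 1 - (n - 1 - i) = i by omega]
      exact hz
    · rintro ⟨i, hi, hz⟩
      rw [hseg i hi] at hz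
      exact ⟨n - 1 - i, by omega, hz⟩

/-- If an end of the polyline lies on its `i`-th segment, then it is an end of that segment. -/
theorem end_of_mem_segment (h : IsPolyline p q A n c) {i : ℕ} (hi : i < n)
    {z : ℂ} (hz : z ∈ segment ℝ (c i) (c (i + 1))) (hpq : z = p ∨ z = q) :
    z = c i ∨ z = c (i + 1) := by
  rcases hpq with rfl | rfl
  · rcases Nat.eq_zero_or_pos i with rfl | hi0
    · exact Or.inl h.zero.symm
    · exact Or.inl (h.simple 0 i hi0 hi z (h.zero ▸ left_mem_segment _ _ _) hz).2
  · rcases (Nat.succ_le_of_lt hi).lt_or_eq with hi' | hi'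
    · have hn : n - 1 + 1 = n := Nat.sub_add_cancel h.pos
      obtain ⟨h1, h2⟩ := h.simple i (n - 1) (by omega) (by omega) z hz
        (by rw [hn, h.last]; exact right_mem_segment _ _ _)
      exact Or.inr (h1 ▸ h2)
    · right
      rw [← h.last, ← hi']

end IsPolyline

namespace PlaneDrawing

open Set PlaneTopology

variable {V : Type u} {G : SimpleGraph V}

/-- A choice of polygonal lines for the edges of a drawing; the line of the edge `uv` is recorded
from `u` to `v` and, reversed, from `v` to `u`. -/
structure Polylines (D : PlaneDrawing G) where
  n : V → V → ℕ
  c : V → V → ℕ → ℂ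
  isPolyline : ∀ u v, G.Adj u v → IsPolyline (D.point u) (D.point v) (D.arc s(u, v)) (n u v) (c u v)
  n_symm : ∀ u v, G.Adj u v → n v u = n u v
  c_symm : ∀ u v, G.Adj u v → ∀ k ≤ n u v, c v u k = c u v (n u v - k)

theorem nonempty_polylines (D : PlaneDrawing G) : Nonempty D.Polylines := by
  classical
  have hex : ∀ u v, ∃ (n : ℕ) (c : ℕ → ℂ), G.Adj u v →
      IsPolyline (D.point u) (D.point v) (D.arc s(u, v)) n c := by
    intro u v
    by_cases h : G.Adj u v
    · obtain ⟨n, c, h1, h2, h3, h4, h5, h6⟩ := D.isPolygonalArc u v h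
      exact ⟨n, c, fun _ => ⟨h1, h2, h3, h4, h5, h6⟩⟩
    · exact ⟨0, fun _ => 0, fun h' => absurd h' h⟩
  choose n c hnc using hex
  -- Each edge is oriented by a well-ordering of the vertices.
  let r : V → V → Prop := WellOrderingRel
  have hasymm : ∀ u v, r u v → ¬ r v u := fun u v h h' => asymm_of WellOrderingRel h h'
  have htot : ∀ u v, u ≠ v → ¬ r u v → r v u := fun u v h h' =>
    ((trichotomous_of WellOrderingRel u v).resolve_left h').resolve_left h
  refine ⟨⟨fun u v => if r u v then n u v else n v u,
    fun u v => if r u v then c u v else fun k => c v u (n v u - k), ?_, ?_, ?_⟩⟩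
  · intro u v h
    by_cases huv : r u v
    · simpa only [if_pos huv] using hnc u v h
    · simp only [if_neg huv]
      rw [Sym2.eq_swap]
      exact (hnc v u h.symm).reverse
  · intro u v h
    by_cases huv : r u v
    · simp only [if_pos huv, if_neg (hasymm u v huv)]
    · simp only [if_neg huv, if_pos (htot u v h.ne huv)]
  · intro u v h k hk
    by_cases huv : r u v
    · simp only [if_pos huv, if_neg (hasymm u v huv)]
    · simp only [if_neg huv, if_pos (htot u v h.ne huv)] at hk ⊢
      rw [Nat.sub_sub_self hk]

namespace Polylines

variable {D : PlaneDrawing G} (C : D.Polylines)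

/-- The segments of the polygonal lines, with both orientations. -/
def segments : Set (ℂ × ℂ) :=
  {e | ∃ u v, G.Adj u v ∧ ∃ i < C.n u v, e = (C.c u v i, C.c u v (i + 1))}

theorem mem_segments {u v : V} (h : G.Adj u v) {i : ℕ} (hi : i < C.n u v) :
    (C.c u v i, C.c u v (i + 1)) ∈ C.segments := ⟨u, v, h, i, hi, rfl⟩

theorem mem_segments_symm {x y : ℂ} (h : (x, y) ∈ C.segments) : (y, x) ∈ C.segments := by
  obtain ⟨u, v, huv, i, hi, he⟩ := h
  obtain ⟨rfl, rfl⟩ := Prod.mk.inj he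
  have hn := C.n_symm u v huv
  refine ⟨v, u, huv.symm, C.n u v - 1 - i, by omega, ?_⟩
  rw [C.c_symm u v huv _ (by omega), C.c_symm u v huv _ (by omega),
    show C.n u v - (C.n u v - 1 - i) = i + 1 by omega,
    show C.n u v - (C.n u v - 1 - i + 1) = i by omega]

theorem segmentSupport_eq : segmentSupport (range D.point) C.segments = D.support := by
  unfold segmentSupport support
  congr 1
  ext z
  simp only [mem_iUnion]
  constructor
  · rintro ⟨_, ⟨u, v, huv, i, hi, rfl⟩, hz⟩
    exact ⟨s(u, v), huv, (C.isPolyline u v huv).segment_subset hi hz⟩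
  · rintro ⟨e, he, hz⟩
    induction e with
    | h u v =>
      rw [(C.isPolyline u v he).eq] at hz
      obtain ⟨i, hi, hz⟩ := hz
      exact ⟨_, C.mem_segments he hi, hz⟩

theorem isSegmentSystem [Finite V] : IsSegmentSystem (range D.point) C.segments where
  finite_points := finite_range _
  finite_segments := by
    refine (finite_iUnion (f := fun q : V × V => ((fun i => (C.c q.1 q.2 i, C.c q.1 q.2 (i + 1))) ''
      Iio (C.n q.1 q.2))) fun q => (finite_Iio _).image _).subset ?_
    rintro _ ⟨u, v, -, i, hi, rfl⟩
    exact mem_iUnion.2 ⟨(u, v), i, hi, rfl⟩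
  ne := by
    rintro x y ⟨u, v, huv, i, hi, he⟩
    obtain ⟨rfl, rfl⟩ := Prod.mk.inj he
    exact (C.isPolyline u v huv).ne i hi
  symm := fun x y h => C.mem_segments_symm h
  inter := by
    -- Two segments of the line from `u` to `v`.
    have same : ∀ u v, G.Adj u v → ∀ i < C.n u v, ∀ j < C.n u v, ∀ z,
        z ∈ segment ℝ (C.c u v i) (C.c u v (i + 1)) →
        z ∈ segment ℝ (C.c u v j) (C.c u v (j + 1)) → i = j ∨
          ((z = C.c u v i ∨ z = C.c u v (i + 1)) ∧ (z = C.c u v j ∨ z = C.c u v (j + 1))) := by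
      intro u v huv i hi j hj z hz hz'
      have hP := C.isPolyline u v huv
      rcases lt_trichotomy i j with hij | hij | hij
      · obtain ⟨rfl, h2⟩ := hP.simple i j hij hj z hz hz'
        exact Or.inr ⟨Or.inr h2, Or.inl h2⟩
      · exact Or.inl hij
      · obtain ⟨rfl, h2⟩ := hP.simple j i hij hi z hz' hz
        exact Or.inr ⟨Or.inl h2, Or.inr h2⟩
    rintro x y x' y' z ⟨u, v, huv, i, hi, he⟩ ⟨u', v', huv', j, hj, he'⟩ hz hz'
    obtain ⟨rfl, rfl⟩ := Prod.mk.inj he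
    obtain ⟨rfl, rfl⟩ := Prod.mk.inj he'
    have hP := C.isPolyline u v huv
    have hP' := C.isPolyline u' v' huv'
    by_cases hs : s(u, v) = s(u', v')
    · rcases Sym2.eq_iff.1 hs with ⟨rfl, rfl⟩ | ⟨rfl, rfl⟩
      · rcases same u v huv i hi j hj z hz hz' with rfl | h
        · exact Or.inl ⟨rfl, rfl⟩
        · exact Or.inr (Or.inr h)
      · have hn := C.n_symm u v huv
        have e1 : C.c v u j = C.c u v (C.n u v - 1 - j + 1) := by
          rw [C.c_symm u v huv _ (by omega)]; congr 1; omega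
        have e2 : C.c v u (j + 1) = C.c u v (C.n u v - 1 - j) := by
          rw [C.c_symm u v huv _ (by omega)]; congr 1; omega
        rw [e1, e2] at hz' ⊢
        rw [segment_symm] at hz'
        rcases same u v huv i hi _ (by omega) z hz hz' with h | h
        · rw [← h]
          exact Or.inr (Or.inl ⟨rfl, rfl⟩)
        · exact Or.inr (Or.inr ⟨h.1, h.2.symm⟩)
    · obtain ⟨w, hw, hw', rfl⟩ := D.inter_arc _ huv _ huv' hs z (hP.segment_subset hi hz)
        (hP'.segment_subset hj hz')
      refine Or.inr (Or.inr ⟨hP.end_of_mem_segment hi hz ?_, hP'.end_of_mem_segment hj hz' ?_⟩)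
      · exact (Sym2.mem_iff.1 hw).imp (congrArg _) (congrArg _)
      · exact (Sym2.mem_iff.1 hw').imp (congrArg _) (congrArg _)
  point := by
    rintro x y ⟨u, v, huv, i, hi, he⟩ _ ⟨w, rfl⟩ hw
    obtain ⟨rfl, rfl⟩ := Prod.mk.inj he
    have hP := C.isPolyline u v huv
    have := D.mem_of_point_mem _ huv w (hP.segment_subset hi hw)
    exact hP.end_of_mem_segment hi hw
      ((Sym2.mem_iff.1 this).imp (congrArg _) (congrArg _))

/-- An interior breakpoint of an edge is the end of exactly two segments. -/
theorem eq_of_mem_segments_interior {u v : V} (h : G.Adj u v) {i : ℕ} (hi : i + 1 < C.n u v)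
    {t : ℂ} (ht : (C.c u v (i + 1), t) ∈ C.segments) :
    t = C.c u v i ∨ t = C.c u v (i + 2) := by
  have hP := C.isPolyline u v h
  obtain ⟨u', v', h', j, hj, he⟩ := ht
  obtain ⟨hc, rfl⟩ := Prod.mk.inj he
  have hP' := C.isPolyline u' v' h'
  by_cases hs : s(u, v) = s(u', v')
  · rcases Sym2.eq_iff.1 hs with ⟨rfl, rfl⟩ | ⟨rfl, rfl⟩
    · rw [← hP.injOn hi.le hj.le hc]
      exact Or.inr rfl
    · have hn := C.n_symm u v h
      rw [C.c_symm u v h _ (by omega)] at hc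
      have := hP.injOn hi.le (Nat.sub_le _ _) hc
      rw [C.c_symm u v h _ (by omega)]
      left
      congr 1
      omega
  · obtain ⟨w, hw, -, hwc⟩ := D.inter_arc _ h _ h' hs _ (hP.mem hi.le) (hc ▸ hP'.mem hj.le)
    rcases Sym2.mem_iff.1 hw with rfl | rfl
    · have := hP.injOn (Nat.zero_le _) hi.le (hP.zero.trans hwc)
      omega
    · have := hP.injOn le_rfl hi.le (hP.last.trans hwc)
      omega

/-- The segments that end at a vertex are the first segments of its edges. -/
theorem eq_of_mem_segments_point {u : V} {t : ℂ} (ht : (D.point u, t) ∈ C.segments) :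
    ∃ v, G.Adj u v ∧ t = C.c u v 1 := by
  obtain ⟨u', v', h', j, hj, he⟩ := ht
  obtain ⟨hc, rfl⟩ := Prod.mk.inj he
  have hP' := C.isPolyline u' v' h'
  have hu := D.mem_of_point_mem _ h' u (hc ▸ hP'.mem hj.le)
  rcases Sym2.mem_iff.1 hu with rfl | rfl
  · obtain rfl := hP'.injOn (Nat.zero_le _) hj.le (hP'.zero.trans hc)
    exact ⟨v', h', rfl⟩
  · have := hP'.injOn le_rfl hj.le (hP'.last.trans hc)
    omega

/-- The direction in which the edge `uv` leaves the vertex `u`. -/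
def dir (u v : V) : ℂ := C.c u v 1 - D.point u

theorem dir_ne_zero {u v : V} (h : G.Adj u v) : C.dir u v ≠ 0 := by
  have hP := C.isPolyline u v h
  refine sub_ne_zero.2 ?_
  rw [← hP.zero]
  exact (hP.ne 0 hP.pos).symm

variable [Finite V]

/-- A face on the right of the first segment of an edge is on the right of all its segments. -/
theorem rightOf_edge {u v : V} (h : G.Adj u v) {F : Set ℂ} {z : ℂ}
    (hF : F = connectedComponentIn D.supportᶜ z) (h0 : RightOf F (C.c u v 0) (C.c u v 1))
    {i : ℕ} (hi : i < C.n u v) : RightOf F (C.c u v i) (C.c u v (i + 1)) := by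
  have hP := C.isPolyline u v h
  induction i with
  | zero => exact h0
  | succ i ih =>
    have hE := C.isSegmentSystem
    rw [← C.segmentSupport_eq] at hF
    have hm := C.mem_segments h (i := i) (by omega)
    have hm' := C.mem_segments h hi
    refine hE.rightOf_turn hF hm hm' (hP.ne_of_lt (by omega) (by omega)) ?_ (ih (by omega))
    intro t ht
    have h0 : C.c u v i - C.c u v (i + 1) ≠ 0 := sub_ne_zero.2 (hE.ne _ _ hm)
    rcases C.eq_of_mem_segments_interior h hi ht with rfl | rfl
    · exact left_notMem_sector _ h0
    · exact right_notMem_sector _ h0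

/-- The same face is on the right of consecutive edges of a path if no edge leaves their common
vertex into the sector on the right-hand side of the path. -/
theorem rightOf_vertex {u v w : V} (h : G.Adj u v) (h' : G.Adj v w) (huw : u ≠ w) {F : Set ℂ}
    {z : ℂ} (hF : F = connectedComponentIn D.supportᶜ z)
    (h0 : RightOf F (C.c u v 0) (C.c u v 1))
    (hsec : ∀ t, G.Adj v t → C.dir v t ∉ sector (C.dir v u) (C.dir v w)) :
    RightOf F (C.c v w 0) (C.c v w 1) := by
  have hP := C.isPolyline u v h
  have hP' := C.isPolyline v w h'
  have hE := C.isSegmentSystem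
  have hn := hP.pos
  have hlast := C.rightOf_edge h hF h0 (i := C.n u v - 1) (by omega)
  rw [← C.segmentSupport_eq] at hF
  have hprev : C.c u v (C.n u v - 1) = C.c v u 1 := (C.c_symm u v h 1 hn).symm
  have hm := C.mem_segments h (i := C.n u v - 1) (by omega)
  have hm' := C.mem_segments h' hP'.pos
  rw [Nat.sub_add_cancel hn, hprev, hP.last] at hm hlast
  rw [zero_add, hP'.zero] at hm'
  rw [hP'.zero]
  refine hE.rightOf_turn hF hm hm' ?_ ?_ hlast
  · intro heq
    have hs : s(u, v) ≠ s(v, w) := by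
      rw [Sym2.eq_swap, Ne, Sym2.congr_right]
      exact huw
    have h1 : C.c v u 1 ∈ D.arc s(u, v) := hprev ▸ hP.mem (Nat.sub_le _ _)
    obtain ⟨x, hx, hx', hxc⟩ := D.inter_arc _ h _ h' hs _ h1 (heq ▸ hP'.mem hP'.pos)
    have hxv : x = v := by
      rcases Sym2.mem_iff.1 hx with rfl | rfl
      · rcases Sym2.mem_iff.1 hx' with rfl | rfl
        · rfl
        · exact absurd rfl huw
      · rfl
    subst hxv
    exact C.dir_ne_zero h.symm (sub_eq_zero.2 hxc.symm)
  · intro t ht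
    obtain ⟨s, hs, rfl⟩ := C.eq_of_mem_segments_point ht
    exact hsec s hs

/-- The ends of a path are on a common face if no edge leaves the path on the right. -/
theorem onSameFace_of_path (z : ℕ → V) {m : ℕ} (hm : 0 < m)
    (hadj : ∀ j < m, G.Adj (z j) (z (j + 1))) (hne : ∀ j, j + 1 < m → z j ≠ z (j + 2))
    (hsec : ∀ j, j + 1 < m → ∀ t, G.Adj (z (j + 1)) t →
      C.dir (z (j + 1)) t ∉ sector (C.dir (z (j + 1)) (z j)) (C.dir (z (j + 1)) (z (j + 2)))) :
    D.OnSameFace (z 0) (z m) := by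
  have hE := C.isSegmentSystem
  have h0 := C.isPolyline _ _ (hadj 0 hm)
  obtain ⟨p, hp, hright⟩ := hE.exists_rightOf (C.mem_segments (hadj 0 hm) h0.pos)
  rw [C.segmentSupport_eq] at hp hright
  have key : ∀ j < m, RightOf (connectedComponentIn D.supportᶜ p)
      (C.c (z j) (z (j + 1)) 0) (C.c (z j) (z (j + 1)) 1) := by
    intro j
    induction j with
    | zero => exact fun _ => hright
    | succ j ih =>
      intro hj
      exact C.rightOf_vertex (hadj j (by omega)) (hadj (j + 1) hj) (hne j hj) rfl
        (ih (by omega)) (hsec j hj)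
  refine ⟨_, ⟨p, hp, rfl⟩, ?_, ?_⟩
  · have := (key 0 hm).mem_closure.1
    rwa [h0.zero] at this
  · obtain ⟨k, rfl⟩ : ∃ k, m = k + 1 := ⟨m - 1, by omega⟩
    have hk := C.isPolyline _ _ (hadj k (by omega))
    have hpos := hk.pos
    have := (C.rightOf_edge (hadj k (by omega)) rfl (key k (by omega))
      (i := C.n (z k) (z (k + 1)) - 1) (by omega)).mem_closure.2
    rwa [Nat.sub_add_cancel hpos, hk.last] at this

end Polylines

theorem OnSameFace.symm {D : PlaneDrawing G} {u v : V} (h : D.OnSameFace u v) :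
    D.OnSameFace v u := by
  obtain ⟨F, hF, hu, hv⟩ := h
  exact ⟨F, hF, hv, hu⟩

/-- The drawing of a subgraph that a drawing of a graph contains. -/
def comap {V' : Type*} {H : SimpleGraph V'} (D : PlaneDrawing G) (φ : SimpleGraph.Copy H G) :
    PlaneDrawing H where
  point v := D.point (φ v)
  arc e := D.arc (e.map φ)
  point_injective := D.point_injective.comp φ.injective
  isPolygonalArc u v h := D.isPolygonalArc _ _ (φ.toHom.map_adj h)
  mem_of_point_mem e he w hw := by
    obtain ⟨v, hv, hvw⟩ := Sym2.mem_map.1 (D.mem_of_point_mem _ (φ.toHom.map_mem_edgeSet he) _ hw)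
    exact φ.injective hvw ▸ hv
  inter_arc e he f hf hef z hz hz' := by
    obtain ⟨w, hw, hw', hwz⟩ := D.inter_arc _ (φ.toHom.map_mem_edgeSet he) _
      (φ.toHom.map_mem_edgeSet hf) ((Sym2.map.injective φ.injective).ne hef) z hz hz'
    obtain ⟨v, hv, rfl⟩ := Sym2.mem_map.1 hw
    obtain ⟨v', hv', hvv⟩ := Sym2.mem_map.1 hw'
    exact ⟨v, hv, φ.injective hvv ▸ hv', hwz⟩

/-- The polygonal lines of the edges of a subgraph. -/
def Polylines.comap {V' : Type*} {H : SimpleGraph V'} {D : PlaneDrawing G} (C : D.Polylines)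
    (φ : SimpleGraph.Copy H G) : (D.comap φ).Polylines where
  n u v := C.n (φ u) (φ v)
  c u v := C.c (φ u) (φ v)
  isPolyline _ _ h := C.isPolyline _ _ (φ.toHom.map_adj h)
  n_symm _ _ h := C.n_symm _ _ (φ.toHom.map_adj h)
  c_symm _ _ h := C.c_symm _ _ (φ.toHom.map_adj h)

end PlaneDrawing

/-! ### Dimension -/

namespace PosetDim

open Set PlaneTopology

section Dimension

variable {P : Type*} [PartialOrder P]

theorem exists_cover_of_dim [Finite P] {I : Set (P × P)} (hI : I ⊆ incPairs P) :
    1 ≤ dim I ∧ ∃ R : Fin (dim I) → Set (P × P), (∀ i, IsReversible (R i)) ∧ I ⊆ ⋃ i, R i :=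
  Nat.sInf_mem (exists_reversible_cover hI)

theorem dim_le_of_cover {ι : Type*} [Fintype ι] {I : Set (P × P)} (R : ι → Set (P × P))
    (hR : ∀ i, IsReversible (R i)) (hI : I ⊆ ⋃ i, R i) {k : ℕ} (hk : 1 ≤ k)
    (hcard : Fintype.card ι ≤ k) : dim I ≤ k := by
  refine Nat.sInf_le ⟨hk, fun j => if h : (j : ℕ) < Fintype.card ι then
    R ((Fintype.equivFin ι).symm ⟨j, h⟩) else ∅, fun j => ?_, fun p hp => ?_⟩
  · dsimp only
    split_ifs
    · exact hR _
    · exact isReversible_empty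
  · obtain ⟨i, hi⟩ := mem_iUnion.1 (hI hp)
    have hlt := (Fintype.equivFin ι i).2
    refine mem_iUnion.2 ⟨⟨Fintype.equivFin ι i, hlt.trans_le hcard⟩, ?_⟩
    simpa [hlt] using hi

/-- A set of pairs is reversible in `P` if its image in `Q` is reversible, provided that the
comparabilities from first to second entries of the pairs persist in `Q`. (An alternating cycle of
`P` would give one of `Q`.) -/
theorem isReversible_of_image {Q : Type*} [PartialOrder Q] {f : P → Q}
    (hf : Function.Injective f) {I : Set (P × P)} (hI : I ⊆ incPairs P)
    (hle : ∀ p ∈ I, ∀ q ∈ I, p.1 ≤ q.2 → f p.1 ≤ f q.2) {S : Set (Q × Q)}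
    (hS : IsReversible S) : IsReversible {p ∈ I | (f p.1, f p.2) ∈ S} := by
  obtain ⟨-, L, hL, hext, hrev⟩ := hS
  have hanti : ∀ x y, L (f x) (f y) → L (f y) (f x) → x = y := fun x y h h' =>
    hf (hL.antisymm _ _ h h')
  -- The order of `P`, extended by the relations that `L` has from second to first entries.
  let T : P → P → Prop := fun x y => x ≤ y ∨
    ∃ p ∈ I, ∃ q ∈ I, x ≤ p.2 ∧ q.1 ≤ y ∧ L (f p.2) (f q.1) ∧ p.2 ≠ q.1
  have hT : IsPartialOrder P T :=
    { refl := fun x => Or.inl le_rfl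
      trans := by
        rintro x y z (h | ⟨p, hp, q, hq, h1, h2, h3, h4⟩) (k | ⟨p', hp', q', hq', k1, k2, k3, k4⟩)
        · exact Or.inl (h.trans k)
        · exact Or.inr ⟨p', hp', q', hq', h.trans k1, k2, k3, k4⟩
        · exact Or.inr ⟨p, hp, q, hq, h1, h2.trans k, h3, h4⟩
        · have h5 := hext _ _ (hle q hq p' hp' (h2.trans k1))
          refine Or.inr ⟨p, hp, q', hq', h1, k2, hL.trans _ _ _ h3 (hL.trans _ _ _ h5 k3), ?_⟩
          intro heq
          exact h4 (hanti _ _ h3 (heq ▸ hL.trans _ _ _ h5 k3))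
      antisymm := by
        rintro x y (h | ⟨p, hp, q, hq, h1, h2, h3, h4⟩) (k | ⟨p', hp', q', hq', k1, k2, k3, k4⟩)
        · exact le_antisymm h k
        · exact absurd (hanti _ _ k3 (hext _ _ (hle q' hq' p' hp' (k2.trans (h.trans k1))))) k4
        · exact absurd (hanti _ _ h3 (hext _ _ (hle q hq p hp (h2.trans (k.trans h1))))) h4
        · have h5 := hext _ _ (hle q hq p' hp' (h2.trans k1))
          have k5 := hext _ _ (hle q' hq' p hp (k2.trans h1))
          exact absurd (hanti _ _ h3 (hL.trans _ _ _ h5 (hL.trans _ _ _ k3 k5))) h4 }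
  obtain ⟨s, hs, hTs⟩ := extend_partialOrder T
  refine ⟨fun p hp => hI hp.1, s, hs, fun x y h => hTs x y (Or.inl h), fun p hp => ?_⟩
  obtain ⟨h1, h2⟩ := hrev _ hp.2
  have hne : p.2 ≠ p.1 := fun h => h2 (congrArg f h)
  exact ⟨hTs _ _ (Or.inr ⟨p, hp.1, p, hp.1, le_rfl, le_rfl, h1, hne⟩), hne⟩

end Dimension

/-! ### Deleting cover relations -/

section Thinned

variable {P : Type u} [PartialOrder P] {r : P → P → Prop}

/-- The poset on the elements of `P` whose covers are those covers of `P` that satisfy `r`. -/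
@[nolint unusedArguments]
def Thinned (P : Type u) [PartialOrder P] (_ : P → P → Prop) : Type u := P

/-- The elements of `P` as elements of `Thinned P r`. -/
def toThinned (r : P → P → Prop) (a : P) : Thinned P r := a

/-- The elements of `Thinned P r` as elements of `P`. -/
def ofThinned (x : Thinned P r) : P := x

instance [Finite P] : Finite (Thinned P r) := ‹Finite P›

theorem le_of_reflTransGen {a b : P}
    (h : Relation.ReflTransGen (fun a b : P => a ⋖ b ∧ r a b) a b) : a ≤ b := by
  induction h with
  | refl => exact le_rfl
  | tail _ h ih => exact ih.trans h.1.le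

instance : PartialOrder (Thinned P r) where
  le := Relation.ReflTransGen (fun a b : P => a ⋖ b ∧ r a b)
  le_refl _ := Relation.ReflTransGen.refl
  le_trans _ _ _ := Relation.ReflTransGen.trans
  le_antisymm _ _ h h' :=
    le_antisymm (α := P) (le_of_reflTransGen h) (le_of_reflTransGen h')

theorem toThinned_le_iff {a b : P} : toThinned r a ≤ toThinned r b ↔
    Relation.ReflTransGen (fun a b : P => a ⋖ b ∧ r a b) a b := Iff.rfl

theorem toThinned_injective : Function.Injective (toThinned r) := fun _ _ h => h

theorem ofThinned_le {x y : Thinned P r} (h : x ≤ y) : ofThinned x ≤ ofThinned y :=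
  le_of_reflTransGen h

theorem ofThinned_lt {x y : Thinned P r} (h : x < y) : ofThinned x < ofThinned y :=
  lt_of_le_of_ne (ofThinned_le h.le) h.ne

theorem toThinned_lt {a b : P} (h : toThinned r a ≤ toThinned r b) (hne : a ≠ b) :
    toThinned r a < toThinned r b := lt_of_le_of_ne h fun h' => hne (toThinned_injective h')

theorem toThinned_covBy_iff {a b : P} : toThinned r a ⋖ toThinned r b ↔ a ⋖ b ∧ r a b := by
  constructor
  · intro h
    rcases Relation.ReflTransGen.cases_head (toThinned_le_iff.1 h.le) with h' | ⟨c, hac, hcb⟩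
    · exact absurd (congrArg (toThinned r) h') h.lt.ne
    · by_cases hc : c = b
      · exact hc ▸ hac
      · exact absurd (toThinned_lt (toThinned_le_iff.2 hcb) hc)
          (h.2 (toThinned_lt (toThinned_le_iff.2 (Relation.ReflTransGen.single hac)) hac.1.ne))
  · rintro ⟨h, hr⟩
    refine ⟨toThinned_lt (Relation.ReflTransGen.single ⟨h, hr⟩) h.ne, fun c hac hcb => ?_⟩
    exact h.2 (ofThinned_lt hac) (ofThinned_lt hcb)

theorem covBy_of_thinned {x y : Thinned P r} (h : x ⋖ y) :
    ofThinned x ⋖ ofThinned y ∧ r (ofThinned x) (ofThinned y) :=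
  toThinned_covBy_iff.1 h

/-- The cover graph of the thinned poset is a subgraph of the cover graph of `P`. -/
def hasseThinnedCopy (r : P → P → Prop) :
    SimpleGraph.Copy (SimpleGraph.hasse (Thinned P r)) (SimpleGraph.hasse P) where
  toHom := ⟨ofThinned, fun h => h.imp (fun h => (covBy_of_thinned h).1)
    fun h => (covBy_of_thinned h).1⟩
  injective' := fun _ _ h => h

theorem posetHeight_thinned_le : posetHeight (Thinned P r) ≤ posetHeight P :=
  iSup_le fun t => encard_le_chainHeight_of_isChain (α := P) univ t.1 (subset_univ _)
    (t.2.2.mono_rel fun _ _ h => ofThinned_le h)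

theorem toThinned_le_of_forall [Finite P] {a b : P} (hab : a ≤ b)
    (h : ∀ x y, a ≤ x → x ⋖ y → y ≤ b → r x y) : toThinned r a ≤ toThinned r b := by
  induction a using WellFoundedGT.induction with
  | ind a ih =>
    rcases hab.eq_or_lt with rfl | hlt
    · exact le_rfl
    · obtain ⟨c, hac, hcb⟩ := exists_covBy_le_of_lt hlt
      refine le_trans (b := toThinned r c) ?_
        (ih c hac.lt hcb fun x y hx => h x y (hac.le.trans hx))
      exact Relation.ReflTransGen.single ⟨hac, h a c le_rfl hac hcb⟩

end Thinned

/-! ### Cutting along a maximal chain between two elements -/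

theorem exists_covBy_chain {P : Type*} [PartialOrder P] [Finite P] {x y : P} (hxy : x ≤ y) :
    ∃ (m : ℕ) (z : ℕ → P), z 0 = x ∧ z m = y ∧ ∀ j < m, z j ⋖ z (j + 1) := by
  induction x using WellFoundedGT.induction with
  | ind x ih =>
    rcases hxy.eq_or_lt with rfl | hlt
    · exact ⟨0, fun _ => x, rfl, rfl, fun j hj => absurd hj (Nat.not_lt_zero j)⟩
    · obtain ⟨t, hxt, hty⟩ := exists_covBy_le_of_lt hlt
      obtain ⟨m, z, h0, hm, hz⟩ := ih t hxt.lt hty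
      refine ⟨m + 1, fun j => Nat.casesOn j x z, rfl, hm, fun j hj => ?_⟩
      cases j with
      | zero => simpa [h0] using hxt
      | succ j => exact hz j (by omega)

section Chain

variable {P : Type u} [PartialOrder P] {z : ℕ → P} {m : ℕ}

theorem chain_lt (hz : ∀ j < m, z j ⋖ z (j + 1)) {j k : ℕ} (hjk : j < k) (hk : k ≤ m) :
    z j < z k := by
  induction k, hjk using Nat.le_induction with
  | base => exact (hz j (by omega)).lt
  | succ k _ ih => exact (ih (by omega)).trans (hz k (by omega)).lt

theorem chain_le (hz : ∀ j < m, z j ⋖ z (j + 1)) {j k : ℕ} (hjk : j ≤ k) (hk : k ≤ m) :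
    z j ≤ z k := by
  rcases hjk.eq_or_lt with rfl | h
  · exact le_rfl
  · exact (chain_lt hz h hk).le

theorem chain_injOn (hz : ∀ j < m, z j ⋖ z (j + 1)) {j k : ℕ} (hj : j ≤ m) (hk : k ≤ m)
    (h : z j = z k) : j = k := by
  rcases lt_trichotomy j k with hjk | hjk | hjk
  · exact absurd h (chain_lt hz hjk hk).ne
  · exact hjk
  · exact absurd h.symm (chain_lt hz hjk hj).ne

theorem chain_length_lt_posetHeight (hz : ∀ j < m, z j ⋖ z (j + 1)) :
    ((m + 1 : ℕ) : ℕ∞) ≤ posetHeight P := by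
  have hinj : InjOn z (Iic m) := fun j hj k hk h => chain_injOn hz hj hk h
  have hchain : IsChain (· ≤ ·) (z '' Iic m) := by
    rintro _ ⟨j, hj, rfl⟩ _ ⟨k, hk, rfl⟩ -
    exact (le_total j k).imp (fun h => chain_le hz h hk) fun h => chain_le hz h hj
  have := encard_le_chainHeight_of_isChain univ _ (subset_univ _) hchain
  rw [hinj.encard_image, ← Finset.coe_Iic, encard_coe_eq_coe_finsetCard, Nat.card_Iic] at this
  exact this

variable {D : PlaneDrawing (SimpleGraph.hasse P)} (C : D.Polylines) (z)

/-- The edge from the chain element `z (j + 1)` to `t` does not leave the chain on the right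
(if `σ` is true) or on the left (if `σ` is false). -/
def KeepAt (σ : Bool) (j : ℕ) (t : P) : Prop :=
  C.dir (z (j + 1)) t ∉ cond σ
    (sector (C.dir (z (j + 1)) (z j)) (C.dir (z (j + 1)) (z (j + 2))))
    (sector (C.dir (z (j + 1)) (z (j + 2))) (C.dir (z (j + 1)) (z j)))

/-- The edge `xy` does not leave the chain `z 0, …, z (i + 1)` on the side `σ` at an interior
element of the chain. -/
def Keep (i : ℕ) (σ : Bool) (x y : P) : Prop :=
  ∀ j < i, (x = z (j + 1) → KeepAt z C σ j y) ∧ (y = z (j + 1) → KeepAt z C σ j x)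

variable {z}

theorem keepAt_or {j : ℕ} (hj : z j ⋖ z (j + 1)) (t : P) :
    KeepAt z C true j t ∨ KeepAt z C false j t := by
  by_cases h : C.dir (z (j + 1)) t ∈ sector (C.dir (z (j + 1)) (z j)) (C.dir (z (j + 1)) (z (j + 2)))
  · exact Or.inr (notMem_sector_swap (C.dir_ne_zero (Or.inr hj)) h)
  · exact Or.inl h

theorem keep_chain (hz : ∀ j < m, z j ⋖ z (j + 1)) {i : ℕ} (hi : i < m) (σ : Bool) {j : ℕ}
    (hj : j ≤ i) : Keep z C i σ (z j) (z (j + 1)) := by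
  intro k hk
  have h1 : C.dir (z (k + 1)) (z k) ≠ 0 := C.dir_ne_zero (Or.inr (hz k (by omega)))
  have h2 : C.dir (z (k + 1)) (z (k + 2)) ≠ 0 := C.dir_ne_zero (Or.inl (hz (k + 1) (by omega)))
  constructor
  · intro h
    obtain rfl := chain_injOn hz (by omega) (by omega) h
    cases σ
    · exact left_notMem_sector _ h2
    · exact right_notMem_sector _ h1
  · intro h
    obtain rfl : j = k := by
      have := chain_injOn hz (by omega) (by omega) h
      omega
    cases σ
    · exact right_notMem_sector _ h2
    · exact left_notMem_sector _ h1

theorem toThinned_chain_le (hz : ∀ j < m, z j ⋖ z (j + 1)) {i : ℕ} (hi : i < m) (σ : Bool) {j : ℕ}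
    (hj : j ≤ i + 1) : toThinned (Keep z C i σ) (z 0) ≤ toThinned (Keep z C i σ) (z j) := by
  induction j with
  | zero => exact le_rfl
  | succ j ih => exact (ih (by omega)).trans (Relation.ReflTransGen.single
      ⟨hz j (by omega), keep_chain C hz hi σ (by omega)⟩)

/-- The elements that are not below the `i`-th element of the chain keep their upsets. -/
theorem toThinned_le_of_not_le [Finite P] (hz : ∀ j < m, z j ⋖ z (j + 1)) {i : ℕ} (hi : i < m)
    (σ : Bool) {a b : P} (ha : ¬ a ≤ z i) (hab : a ≤ b) :
    toThinned (Keep z C i σ) a ≤ toThinned (Keep z C i σ) b := by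
  have hne : ∀ x, a ≤ x → ∀ j < i, x ≠ z (j + 1) := by
    rintro _ hx j hj rfl
    exact ha (hx.trans (chain_le hz (by omega) hi.le))
  refine toThinned_le_of_forall hab fun x y hx hxy _ j hj => ⟨fun h => ?_, fun h => ?_⟩
  · exact absurd h (hne x hx j hj)
  · exact absurd h (hne y (hx.trans hxy.le) j hj)

/-- An upward path from `z 0` that leaves the chain for good at an interior element leaves it on
only one side, so it survives when the edges on the other side are deleted. -/
theorem exists_toThinned_le [Finite P] (hz : ∀ j < m, z j ⋖ z (j + 1)) {i : ℕ} (hi : i < m)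
    {b : P} (hb : z 0 ≤ b) (hb' : ¬ z (i + 1) ≤ b) :
    ∃ σ, toThinned (Keep z C i σ) (z 0) ≤ toThinned (Keep z C i σ) b := by
  classical
  obtain ⟨j, hji, hj, hj'⟩ : ∃ j ≤ i, z j ≤ b ∧ ¬ z (j + 1) ≤ b := by
    have hex : ∃ k, ¬ z k ≤ b := ⟨_, hb'⟩
    have hpos : Nat.find hex ≠ 0 := fun h0 => Nat.find_spec hex (h0 ▸ hb)
    have hle := Nat.find_min' hex hb'
    refine ⟨Nat.find hex - 1, by omega, ?_, ?_⟩
    · exact not_not.1 (Nat.find_min hex (m := Nat.find hex - 1) (by omega))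
    · rw [show Nat.find hex - 1 + 1 = Nat.find hex by omega]
      exact Nat.find_spec hex
  rcases hj.eq_or_lt with rfl | hlt
  · exact ⟨true, toThinned_chain_le C hz hi true (by omega)⟩
  obtain ⟨t, hjt, htb⟩ := exists_covBy_le_of_lt hlt
  have hne : ∀ x, t ≤ x → x ≤ b → ∀ l < i, x ≠ z (l + 1) := by
    rintro _ htx hxb l hl rfl
    have hlj : l + 1 ≤ j := by
      by_contra hlj
      exact hj' ((chain_le hz (by omega) (by omega)).trans hxb)
    exact absurd (htx.trans (chain_le hz hlj (by omega))) hjt.lt.not_ge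
  have htb' : ∀ σ, toThinned (Keep z C i σ) t ≤ toThinned (Keep z C i σ) b := fun σ =>
    toThinned_le_of_forall htb fun x y hx hxy hy l hl =>
      ⟨fun h => absurd h (hne x hx (hxy.le.trans hy) l hl),
        fun h => absurd h (hne y (hx.trans hxy.le) hy l hl)⟩
  obtain ⟨σ, hσ⟩ : ∃ σ, Keep z C i σ (z j) t := by
    cases j with
    | zero =>
      refine ⟨true, fun l hl => ⟨fun h => ?_, fun h => absurd h (hne t le_rfl htb l hl)⟩⟩
      have := chain_injOn hz (by omega) (by omega) h
      omega
    | succ j =>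
      obtain ⟨σ, hσ⟩ : ∃ σ, KeepAt z C σ j t :=
        (keepAt_or C (hz j (by omega)) t).elim (fun h => ⟨true, h⟩) fun h => ⟨false, h⟩
      refine ⟨σ, fun l hl => ⟨fun h => ?_, fun h => absurd h (hne t le_rfl htb l hl)⟩⟩
      obtain rfl : j = l := by
        have := chain_injOn hz (by omega) (by omega) h
        omega
      exact hσ
  exact ⟨σ, (toThinned_chain_le C hz hi σ (by omega)).trans
    (le_trans (b := toThinned (Keep z C i σ) t) (Relation.ReflTransGen.single ⟨hjt, hσ⟩) (htb' σ))⟩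

/-- Once the edges that leave the chain `z 0, …, z (i + 1)` on one side are deleted, the ends of the
chain are on a common face, which lies along that side. -/
theorem exists_drawing_onSameFace [Finite P] (hz : ∀ j < m, z j ⋖ z (j + 1)) {i : ℕ} (hi : i < m)
    (σ : Bool) : ∃ D' : PlaneDrawing (SimpleGraph.hasse (Thinned P (Keep z C i σ))),
      D'.OnSameFace (toThinned _ (z 0)) (toThinned _ (z (i + 1))) := by
  set r := Keep z C i σ with hr
  let C' := C.comap (hasseThinnedCopy r)
  have hadj : ∀ j < i + 1, (SimpleGraph.hasse (Thinned P r)).Adj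
      (toThinned r (z j)) (toThinned r (z (j + 1))) := fun j hj =>
    Or.inl (toThinned_covBy_iff.2 ⟨hz j (by omega), keep_chain C hz hi σ (by omega)⟩)
  have hkeep : ∀ j < i, ∀ t, (SimpleGraph.hasse (Thinned P r)).Adj (toThinned r (z (j + 1))) t →
      KeepAt z C σ j (ofThinned t) := by
    rintro j hj t (h | h)
    · exact ((covBy_of_thinned h).2 j hj).1 rfl
    · exact ((covBy_of_thinned h).2 j hj).2 rfl
  refine ⟨D.comap (hasseThinnedCopy r), ?_⟩
  cases σ
  -- The left-hand side of the chain is the right-hand side of the reversed chain.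
  · have h := C'.onSameFace_of_path (fun j => toThinned r (z (i + 1 - j))) (m := i + 1)
      (by omega) ?_ ?_ ?_
    · simpa using h.symm
    · intro j hj
      have := (hadj (i - j) (by omega)).symm
      rw [show i - j + 1 = i + 1 - j by omega, show i - j = i + 1 - (j + 1) by omega] at this
      exact this
    · intro j hj h
      have := chain_injOn hz (by omega) (by omega) h
      omega
    · intro j hj t ht
      obtain ⟨k, hk⟩ : ∃ k, i = k + j + 1 := ⟨i - j - 1, by omega⟩
      have e0 : i + 1 - (j + 1) = k + 1 := by omega
      have e1 : i + 1 - j = k + 2 := by omega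
      have e2 : i + 1 - (j + 2) = k := by omega
      simp only [e0, e1, e2] at ht ⊢
      exact hkeep k (by omega) t ht
  · refine C'.onSameFace_of_path (fun j => toThinned r (z j)) (m := i + 1) (by omega) hadj ?_ ?_
    · intro j hj h
      have := chain_injOn hz (by omega) (by omega) h
      omega
    · intro j hj t ht
      exact hkeep j (by omega) t ht

end Chain

end PosetDim

/-! ### The reduction to doubly exposed sets -/

theorem lemma2p5 {P : Type u} [PartialOrder P] [Finite P] (h : ℕ)
    (hheight : PosetDim.posetHeight P = h)
    (hplanar : IsPlanarGraph (SimpleGraph.hasse P))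
    (I : Set (P × P)) (hI : PosetDim.IsDoublyConstrained I) :
    ∃ (Q : Type u) (_ : PartialOrder Q) (_ : Finite Q) (J : Set (Q × Q)),
      PosetDim.posetHeight Q ≤ h ∧
      (SimpleGraph.hasse Q).IsContained (SimpleGraph.hasse P) ∧
      PosetDim.IsDoublyExposed J ∧
      PosetDim.dim I ≤ 2 * (h - 1) * PosetDim.dim J := by
  classical
  open PosetDim in
  obtain ⟨D⟩ := hplanar
  obtain ⟨C⟩ := D.nonempty_polylines
  obtain ⟨x₀, y₀, hIc⟩ := hI
  obtain ⟨m, z, rfl, rfl, hz⟩ := exists_covBy_chain hIc.lt.le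
  have hmh : m + 1 ≤ h := by
    have := chain_length_lt_posetHeight hz
    rw [hheight] at this
    exact_mod_cast this
  let r : Fin m × Bool → P → P → Prop := fun k => Keep z C k.1 k.2
  -- The pairs are classified by the first chain element above `p.1`, and by the side on which a
  -- path from `z 0` to `p.2` leaves the chain below that element.
  let cls : Fin m × Bool → Set (P × P) := fun k =>
    {p ∈ I | ¬ p.1 ≤ z k.1 ∧ p.1 ≤ z (k.1 + 1) ∧ toThinned (r k) (z 0) ≤ toThinned (r k) p.2}
  have hcover : I ⊆ ⋃ k, cls k := by
    intro p hp
    obtain ⟨⟨hinc1, -⟩, -, -⟩ := hIc.subset_incMinMax hp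
    have hex : ∃ k, p.1 ≤ z k := ⟨m, (hIc.fst_lt p hp).le⟩
    have hpos : Nat.find hex ≠ 0 := fun h0 =>
      hinc1 ((h0 ▸ Nat.find_spec hex : p.1 ≤ z 0).trans (hIc.lt_snd p hp).le)
    have hle := Nat.find_min' hex (hIc.fst_lt p hp).le
    obtain ⟨i, hi⟩ : ∃ i, Nat.find hex = i + 1 := ⟨Nat.find hex - 1, by omega⟩
    have h1 : p.1 ≤ z (i + 1) := hi ▸ Nat.find_spec hex
    have h2 : ¬ p.1 ≤ z i := Nat.find_min hex (by omega)
    obtain ⟨σ, hσ⟩ := exists_toThinned_le C hz (show i < m by omega) (hIc.lt_snd p hp).le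
      fun h' => hinc1 (h1.trans h')
    exact Set.mem_iUnion.2 ⟨(⟨i, by omega⟩, σ), hp, h2, h1, hσ⟩
  let J : ∀ k, Set (Thinned P (r k) × Thinned P (r k)) := fun k =>
    Prod.map (toThinned (r k)) (toThinned (r k)) '' cls k
  have hJ : ∀ k, J k ⊆ incMinMax (Thinned P (r k)) := by
    rintro k _ ⟨p, hp, rfl⟩
    obtain ⟨⟨hinc1, hinc2⟩, hmin, hmax⟩ := hIc.subset_incMinMax hp.1
    exact ⟨⟨fun h' => hinc1 (ofThinned_le h'), fun h' => hinc2 (ofThinned_le h')⟩,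
      fun c hc => (show ofThinned c = p.1 from hmin.eq_of_le (ofThinned_le hc)) ▸ le_rfl,
      fun c hc => (show p.2 = ofThinned c from hmax.eq_of_le (ofThinned_le hc)) ▸ le_rfl⟩
  -- Choose the nonempty class of the largest dimension.
  have hne : Nonempty {k // (cls k).Nonempty} := by
    obtain ⟨p, hp⟩ := hIc.nonempty
    obtain ⟨k, hk⟩ := Set.mem_iUnion.1 (hcover hp)
    exact ⟨⟨k, p, hk⟩⟩
  obtain ⟨⟨k₀, hk₀⟩, hmax⟩ := Finite.exists_max fun k : {k // (cls k).Nonempty} => dim (J k.1)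
  have hd : 1 ≤ dim (J k₀) := (exists_cover_of_dim fun p hp => (hJ k₀ hp).1).1
  have hcls : ∀ k, ∃ R : Fin (dim (J k₀)) → Set (P × P),
      (∀ l, IsReversible (R l)) ∧ cls k ⊆ ⋃ l, R l := by
    intro k
    rcases (cls k).eq_empty_or_nonempty with hk | hk
    · exact ⟨fun _ => ∅, fun _ => isReversible_empty, by simp [hk]⟩
    · obtain ⟨-, R, hR, hJR⟩ := exists_cover_of_dim fun p hp => (hJ k hp).1
      have hlek : dim (J k) ≤ dim (J k₀) := hmax ⟨k, hk⟩
      refine ⟨fun l => if hl : (l : ℕ) < dim (J k) then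
        {p ∈ cls k | (toThinned (r k) p.1, toThinned (r k) p.2) ∈ R ⟨l, hl⟩} else ∅, ?_, ?_⟩
      · intro l
        dsimp only
        split_ifs
        · exact isReversible_of_image toThinned_injective
            (fun p hp => (hIc.subset_incMinMax hp.1).1)
            (fun p hp q _ hpq => toThinned_le_of_not_le C hz k.1.2 k.2 hp.2.1 hpq) (hR _)
        · exact isReversible_empty
      · intro p hp
        obtain ⟨l, hl⟩ := Set.mem_iUnion.1 (hJR ⟨p, hp, rfl⟩)
        refine Set.mem_iUnion.2 ⟨⟨l, l.2.trans_le hlek⟩, ?_⟩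
        simp only [dif_pos l.2]
        exact ⟨hp, hl⟩
  choose R hR hclsR using hcls
  obtain ⟨D', hD'⟩ := exists_drawing_onSameFace C hz k₀.1.2 k₀.2
  refine ⟨Thinned P (r k₀), inferInstance, inferInstance, J k₀, ?_, ⟨hasseThinnedCopy _⟩,
    ⟨toThinned _ (z 0), toThinned _ (z (k₀.1 + 1)), ⟨hk₀.image _, hJ k₀, ?_, ?_, ?_⟩, D', hD'⟩, ?_⟩
  · exact hheight ▸ posetHeight_thinned_le
  · exact toThinned_lt (toThinned_chain_le C hz k₀.1.2 k₀.2 le_rfl)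
      (chain_lt hz (Nat.succ_pos _) k₀.1.2).ne
  · rintro _ ⟨p, hp, rfl⟩
    exact toThinned_lt hp.2.2.2 (hIc.lt_snd p hp.1).ne
  · rintro _ ⟨p, hp, rfl⟩
    -- The element `p.1` is minimal, so it is not above `z 0` on the chain.
    have hne : p.1 ≠ z (k₀.1 + 1) := fun heq =>
      (hIc.subset_incMinMax hp.1).2.1.not_lt (heq ▸ chain_lt hz (Nat.succ_pos _) k₀.1.2)
    exact toThinned_lt (a := p.1) (toThinned_le_of_not_le C hz k₀.1.2 k₀.2 hp.2.1 hp.2.2.1) hne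
  · have hm : 1 ≤ m := Nat.one_le_iff_ne_zero.2 fun h0 => hIc.lt.ne (by rw [h0])
    refine dim_le_of_cover (fun q : (Fin m × Bool) × Fin (dim (J k₀)) => R q.1 q.2)
      (fun q => hR _ _) (fun p hp => ?_) ?_ ?_
    · obtain ⟨k, hk⟩ := Set.mem_iUnion.1 (hcover hp)
      obtain ⟨l, hl⟩ := Set.mem_iUnion.1 (hclsR k hk)
      exact Set.mem_iUnion.2 ⟨(k, l), hl⟩
    · exact Nat.mul_pos (Nat.mul_pos two_pos (by omega)) hd
    · rw [Fintype.card_prod, Fintype.card_prod, Fintype.card_fin, Fintype.card_fin,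
        Fintype.card_bool]
      exact Nat.mul_le_mul_right _ (by omega)
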